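/- For $x\in\{0,1\}^n$ let $Z^x=Z^{x_1}\otimes\cdots\otimes Z^{x_n}$, where $Z$ is the Pauli $Z$ matrix, and let $\mathrm{Haar}(d)$ denote the uniform distribution on unit vectors of $\mathbb{C}^d$. There is a constant $C>0$ such that the following holds for all integers $n,m\ge 1$ with $2^n>2(m+1)$. Consider the ensemble of states on $(\mathbb{C}^{2^n})^{\otimes (m+1)}$ $$\rho_x=\mathbb{E}_{|\psi\rangle\leftarrow \mathrm{Haar}(2^n)}\Big[(Z^x\otimes I^{\otimes m})\,(|\psi\rangle\langle\psi|)^{\otimes (m+1)}\,(Z^x\otimes I^{\otimes m})\Big],\qquad x\in\{0,1\}^n .$$ Then for every POVM $\{M_x\}_{x\in\{0,1\}^n}$ on $(\mathbb{C}^{2^n})^{\otimes (m+1)}$ (positive semidefinite matrices with $\sum_x M_x=I$), $$\mathbb{E}_{x\leftarrow\{0,1\}^n}\,\mathrm{Tr}[M_x\rho_x] \;<\; C\cdot\left(\frac{m}{2^n}+\frac{m^7}{2^{3n}}\right)^{1/2},$$ where $x$ is uniformly random. The constant $C$ does not depend on $n$, $m$ or the POVM. -/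

import Mathlib

open MeasureTheory
open scoped ComplexOrder

/-- Bit strings `{0,1}^n`; they also label the standard basis of the space of `n` qubits. -/
abbrev BitString (n : ℕ) : Type := Fin n → Bool

/-- The tensor product `A 0 ⊗ A 1 ⊗ ⋯ ⊗ A (k-1)` of square matrices acting on `ℂ^ι`, as a matrix
acting on `(ℂ^ι)^{⊗k}`, whose standard basis is labelled by `Fin k → ι`. -/
def tensorProd {ι : Type*} {k : ℕ} (A : Fin k → Matrix ι ι ℂ) :
    Matrix (Fin k → ι) (Fin k → ι) ℂ :=
  Matrix.of fun a b => ∏ i, A i (a i) (b i)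

/-- The Pauli `Z` matrix, `|0⟩ ↦ |0⟩`, `|1⟩ ↦ -|1⟩`. -/
def pauliZ : Matrix Bool Bool ℂ :=
  Matrix.diagonal fun b => if b then -1 else 1

/-- `Z^x = Z^{x_1} ⊗ ⋯ ⊗ Z^{x_n}`. -/
def pauliZString {n : ℕ} (x : BitString n) : Matrix (BitString n) (BitString n) ℂ :=
  tensorProd fun i => if x i then pauliZ else 1

/-- `Z^x ⊗ I^{⊗m}`, acting on `m + 1` registers of `n` qubits each. -/
def pauliZOnFirst {n : ℕ} (m : ℕ) (x : BitString n) :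
    Matrix (Fin (m + 1) → BitString n) (Fin (m + 1) → BitString n) ℂ :=
  tensorProd (Fin.cons (pauliZString x) fun _ => 1)

/-- The pure states on `ℂ^ι`: unit vectors for the Euclidean norm. -/
abbrev UnitVector (ι : Type*) [Fintype ι] : Type _ :=
  Metric.sphere (0 : EuclideanSpace ℂ ι) 1

/-- The Haar distribution on pure states: the uniform distribution on the unit sphere of `ℂ^ι`,
that is, the surface measure normalized to total mass one. -/
noncomputable def haarState (ι : Type*) [Fintype ι] : Measure (UnitVector ι) :=
  ((volume : Measure (EuclideanSpace ℂ ι)).toSphere Set.univ)⁻¹ •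
    (volume : Measure (EuclideanSpace ℂ ι)).toSphere

/-- The projector `|ψ⟩⟨ψ|`. -/
def ketBra {ι : Type*} [Fintype ι] (ψ : UnitVector ι) : Matrix ι ι ℂ :=
  Matrix.of fun a b => ψ.1 a * star (ψ.1 b)

/-- The mixed state
`ρ_x = E_{ψ ← Haar(2^n)} [(Z^x ⊗ I^{⊗m}) (|ψ⟩⟨ψ|)^{⊗(m+1)} (Z^x ⊗ I^{⊗m})]`,
the expectation of a matrix being taken entry by entry. -/
noncomputable def rho {n : ℕ} (m : ℕ) (x : BitString n) :
    Matrix (Fin (m + 1) → BitString n) (Fin (m + 1) → BitString n) ℂ :=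
  Matrix.of fun a b => ∫ ψ : UnitVector (BitString n),
    (pauliZOnFirst m x * tensorProd (fun _ : Fin (m + 1) => ketBra ψ) * pauliZOnFirst m x) a b
      ∂(haarState (BitString n))

/-- `M` is a POVM with outcomes in `X`: positive semidefinite matrices that sum to the identity. -/
structure IsPOVM {X κ : Type*} [Fintype X] [Fintype κ] [DecidableEq κ]
    (M : X → Matrix κ κ ℂ) : Prop where
  posSemidef : ∀ x, (M x).PosSemidef
  sum_eq_one : ∑ x, M x = 1

/-- The probability `E_{x ← X} Tr[M_x ρ_x]` of guessing a uniformly random `x` from one copy of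
`ρ_x` by measuring the POVM `M`. -/
noncomputable def guessingProb {X κ : Type*} [Fintype X] [Fintype κ]
    (M ρ : X → Matrix κ κ ℂ) : ℝ :=
  (Fintype.card X : ℝ)⁻¹ * ∑ x, ((M x * ρ x).trace).re

/-!
The guessing probability is bounded by `(m + 1) / (m + d)` with `d = 2^n`, which is at most `2m / d`
and hence at most `2 √(m / d)`, so the second term under the root is not needed.

The reason is an operator inequality. The average of `|ψ⟩⟨ψ|^{⊗(m+1)}` over Haar random `ψ` is the
normalized projection onto the symmetric subspace of `(ℂ^d)^{⊗(m+1)}`. That subspace lies in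
`ℂ^d ⊗ Sym^m(ℂ^d)`, and the ratio of the normalizations gives
`E[|ψ⟩⟨ψ|^{⊗(m+1)}] ≤ (m + 1) / (m + d) • (I ⊗ E[|ψ⟩⟨ψ|^{⊗m}])` (`integral_norm_sq_le_sum_cons`).
The right side commutes with `Z^x ⊗ I`, so every `ρ_x` is bounded by the same operator, whose trace
is `d (m + 1) / (m + d)`. As the `M_x` sum to the identity, the sum of `Tr[M_x ρ_x]` over `x` is at
most this trace, and dividing by the number `d` of strings proves the bound
(`guessingProb_rho_le`).

Tensors are handled in coordinates, as functions on words `a : Fin k → ι`, with `ψ^a` standing for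
`∏ i, ψ (a i)`. The Haar moments are computed from Gaussian ones by polar coordinates
(`exists_integral_haarState_word`): the average of `ψ^a` times the conjugate of `ψ^b` is proportional
to the number of permutations of the positions that carry `b` to `a`. Consequently the mean square of
a form `∑ a, w a ψ^a` is a multiple of the squared norm of the symmetrization of `w`, the inclusion of
symmetric subspaces becomes the Cauchy-Schwarz estimate `symNormSq_le_sum_cons`, and the ratio of
normalizations is `haar_moment_recurrence`.
-/

/-! ### Rearrangements of words -/

/-- The number of occurrences of the letter `j` in the word `a`. -/
def letterCount {ι : Type*} [DecidableEq ι] {k : ℕ} (a : Fin k → ι) (j : ι) : ℕ :=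
  (Finset.univ.filter fun i => a i = j).card

theorem prod_word_eq_prod_pow {ι : Type*} [Fintype ι] [DecidableEq ι] {k : ℕ} (a : Fin k → ι)
    (z : ι → ℂ) : ∏ i, z (a i) = ∏ j, z j ^ letterCount a j := by
  rw [← Finset.prod_fiberwise Finset.univ a]
  refine Finset.prod_congr rfl fun j _ => ?_
  rw [Finset.prod_congr rfl (g := fun _ => z j), Finset.prod_const, letterCount]
  intro i hi
  rw [(Finset.mem_filter.mp hi).2]

/-- Words with the same letter counts are rearrangements of each other: the fibres of `a` and `b` over
each letter are matched by bijections, which glue to a permutation of the positions. -/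
theorem exists_perm_comp_eq {ι : Type*} [DecidableEq ι] {k : ℕ} {a b : Fin k → ι}
    (h : letterCount a = letterCount b) : ∃ σ : Equiv.Perm (Fin k), b ∘ σ = a := by
  have e : ∀ j, Nonempty ({i // a i = j} ≃ {i // b i = j}) := fun j => by
    refine Fintype.card_eq.mp ?_
    rw [Fintype.card_subtype, Fintype.card_subtype]
    exact congrFun h j
  replace e := fun j => (e j).some
  refine ⟨(Equiv.sigmaFiberEquiv a).symm.trans
    ((Equiv.sigmaCongrRight e).trans (Equiv.sigmaFiberEquiv b)), ?_⟩
  funext i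
  exact (e (a i) ⟨i, rfl⟩).2

theorem letterCount_comp_perm {ι : Type*} [DecidableEq ι] {k : ℕ} (a : Fin k → ι)
    (σ : Equiv.Perm (Fin k)) : letterCount (a ∘ σ) = letterCount a := by
  funext j
  rw [letterCount, letterCount, ← Fintype.card_subtype, ← Fintype.card_subtype]
  exact Fintype.card_congr (σ.subtypeEquiv fun i => Iff.rfl)

/-- The number of rearrangements of the positions carrying `b` to `a`: they form a coset of the
stabilizer of `a`, which is the product of the symmetric groups of the fibres. -/
theorem card_perm_comp_eq {ι : Type*} [Fintype ι] [DecidableEq ι] {k : ℕ} (a b : Fin k → ι) :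
    (Finset.univ.filter fun σ : Equiv.Perm (Fin k) => b ∘ σ = a).card =
      if letterCount a = letterCount b then ∏ j, (letterCount a j).factorial else 0 := by
  split_ifs with h
  · obtain ⟨τ, hτ⟩ := exists_perm_comp_eq h.symm
    have h1 := DomMulAct.stabilizer_card a
    simp only [Fintype.card_subtype] at h1
    unfold letterCount
    rw [← h1]
    refine Finset.card_equiv (Equiv.mulLeft τ) fun σ => ?_
    simp only [Finset.mem_filter, Finset.mem_univ, true_and, Equiv.coe_mulLeft,
      Equiv.Perm.coe_mul, ← Function.comp_assoc, ← hτ]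
  · rw [Finset.card_eq_zero, Finset.filter_eq_empty_iff]
    rintro σ - rfl
    exact h (letterCount_comp_perm b σ)

/-! ### Gaussian moments -/

/-- Distinct powers of a complex Gaussian are orthogonal, and the `p`-th one has squared norm `p!`,
up to the factor `π` that normalizes the density. -/
theorem integral_pow_mul_conj_pow_mul_exp (p q : ℕ) :
    ∫ z : ℂ, z ^ p * star z ^ q * (Real.exp (-‖z‖ ^ 2) : ℂ) =
      if p = q then (Real.pi * p.factorial : ℂ) else 0 := by
  split_ifs with h
  · subst h
    have h1 := Complex.integral_rpow_mul_exp_neg_rpow (p := 2) (q := 2 * p) (by norm_num)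
      (by have : (0 : ℝ) ≤ p := p.cast_nonneg
          linarith)
    have h2 : (2 * (p : ℝ) + 2) / 2 = p + 1 := by ring
    rw [h2, Real.Gamma_nat_eq_factorial] at h1
    have h3 : ∀ z : ℂ, z ^ p * star z ^ p * (Real.exp (-‖z‖ ^ 2) : ℂ) =
        ((‖z‖ ^ (2 * (p : ℝ)) * Real.exp (-‖z‖ ^ (2 : ℝ)) : ℝ) : ℂ) := fun z => by
      have : ‖z‖ ^ (2 * (p : ℝ)) = (‖z‖ ^ 2) ^ p := by
        rw [Real.rpow_mul (norm_nonneg z), Real.rpow_natCast, Real.rpow_two]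
      rw [this, Real.rpow_two, ← mul_pow, Complex.star_def, Complex.mul_conj,
        Complex.normSq_eq_norm_sq]
      push_cast
      rfl
    simp_rw [h3]
    rw [integral_complex_ofReal, h1]
    push_cast
    ring
  · -- rotating `z` by the angle `π / (p - q)` flips the sign of the integrand
    have hpq : ((p : ℝ) - q) ≠ 0 := sub_ne_zero.mpr (by exact_mod_cast h)
    set ω : Circle := Circle.exp (Real.pi / (p - q)) with hω
    have hflip : (ω : ℂ) ^ p * star (ω : ℂ) ^ q = -1 := by
      rw [Complex.star_def, ← Circle.coe_inv_eq_conj, hω, ← Circle.exp_neg, Circle.coe_exp,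
        Circle.coe_exp, ← Complex.exp_nat_mul, ← Complex.exp_nat_mul, ← Complex.exp_add,
        ← Complex.exp_pi_mul_I]
      congr 1
      have hc : ((p : ℂ) - q) ≠ 0 := by exact_mod_cast hpq
      push_cast
      field_simp
      ring
    have h1 := (rotation ω).measurePreserving.integral_comp
      (rotation ω).toHomeomorph.measurableEmbedding
      (fun z : ℂ => z ^ p * star z ^ q * (Real.exp (-‖z‖ ^ 2) : ℂ))
    have h2 : ∀ z : ℂ, (rotation ω z) ^ p * star (rotation ω z) ^ q *
        (Real.exp (-‖rotation ω z‖ ^ 2) : ℂ) =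
        -(z ^ p * star z ^ q * (Real.exp (-‖z‖ ^ 2) : ℂ)) := fun z => by
      rw [LinearIsometryEquiv.norm_map, rotation_apply, star_mul', mul_pow, mul_pow]
      linear_combination (z ^ p * star z ^ q * (Real.exp (-‖z‖ ^ 2) : ℂ)) * hflip
    simp_rw [h2] at h1
    rw [integral_neg] at h1
    exact CharZero.neg_eq_self_iff.mp h1

/-- **Wick's formula** for independent complex Gaussians, up to the normalization of the density: a
mixed moment counts the pairings of the factors with the conjugate factors. -/
theorem integral_pi_gaussian_word {ι : Type*} [Fintype ι] [DecidableEq ι] {k : ℕ}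
    (a b : Fin k → ι) :
    ∫ z : ι → ℂ, (∏ i, z (a i)) * star (∏ i, z (b i)) * (Real.exp (-∑ j, ‖z j‖ ^ 2) : ℂ) =
      Real.pi ^ Fintype.card ι *
        (Finset.univ.filter fun σ : Equiv.Perm (Fin k) => b ∘ σ = a).card := by
  have h1 : ∀ z : ι → ℂ,
      (∏ i, z (a i)) * star (∏ i, z (b i)) * (Real.exp (-∑ j, ‖z j‖ ^ 2) : ℂ) =
      ∏ j, (z j ^ letterCount a j * star (z j) ^ letterCount b j *
        (Real.exp (-‖z j‖ ^ 2) : ℂ)) := fun z => by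
    rw [Finset.prod_mul_distrib, Finset.prod_mul_distrib, prod_word_eq_prod_pow a,
      prod_word_eq_prod_pow b, star_prod, ← Finset.sum_neg_distrib, Real.exp_sum]
    simp only [star_pow, Complex.ofReal_prod]
  simp_rw [h1]
  rw [volume_pi, integral_fintype_prod_eq_prod (𝕜 := ℂ) (fun j (w : ℂ) =>
    w ^ letterCount a j * star w ^ letterCount b j * (Real.exp (-‖w‖ ^ 2) : ℂ))]
  simp_rw [integral_pow_mul_conj_pow_mul_exp]
  rw [card_perm_comp_eq]
  split_ifs with h
  · rw [h]
    simp [Finset.prod_mul_distrib, Finset.card_univ]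
  · obtain ⟨j, hj⟩ := Function.ne_iff.mp h
    rw [Finset.prod_eq_zero (Finset.mem_univ j) (if_neg hj)]
    simp

/-! ### Moments of the Haar measure on the sphere -/

/-- The volume of the Euclidean norm on `ℂ^ι` is a positive multiple of the product measure. The value
of the multiple is immaterial here, since Haar averages are normalized. -/
theorem integral_eq_smul_integral_pi {ι : Type*} [Fintype ι] :
    ∃ c : ℝ, 0 < c ∧ ∀ f : (ι → ℂ) → ℂ,
      ∫ z : EuclideanSpace ℂ ι, f z.ofLp = c * ∫ z : ι → ℂ, f z := by
  let e : EuclideanSpace ℂ ι ≃L[ℂ] (ι → ℂ) := PiLp.continuousLinearEquiv 2 ℂ fun _ => ℂ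
  have : (Measure.map e (volume : Measure (EuclideanSpace ℂ ι))).IsAddHaarMeasure :=
    e.isAddHaarMeasure_map _
  refine ⟨((Measure.map e volume).addHaarScalarFactor (volume : Measure (ι → ℂ)) : NNReal),
    NNReal.coe_pos.mpr (Measure.addHaarScalarFactor_pos_of_isAddHaarMeasure _ _), fun f => ?_⟩
  have h1 : ∫ z : EuclideanSpace ℂ ι, f z.ofLp = ∫ z, f z ∂(Measure.map e volume) :=
    (e.toHomeomorph.measurableEmbedding.integral_map f).symm
  rw [h1]
  conv_lhs => rw [Measure.isAddLeftInvariant_eq_smul (Measure.map e volume)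
    (volume : Measure (ι → ℂ))]
  rw [integral_smul_nnreal_measure]
  rfl

/-- Integration in polar coordinates of a function that separates into an angular and a radial part. -/
theorem integral_eq_integral_sphere_mul {E : Type*} [NormedAddCommGroup E] [NormedSpace ℝ E]
    [MeasurableSpace E] [BorelSpace E] [FiniteDimensional ℝ E] [Nontrivial E] (μ : Measure E)
    [μ.IsAddHaarMeasure] (f : E → ℂ) (g : Metric.sphere (0 : E) 1 → ℂ) (h : ℝ → ℂ)
    (hf : ∀ (u : Metric.sphere (0 : E) 1) (r : ℝ), 0 < r → f (r • u.1) = g u * h r) :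
    ∫ x, f x ∂μ = (∫ u, g u ∂μ.toSphere) *
      ∫ r : Set.Ioi (0 : ℝ), h r ∂(.volumeIoiPow (Module.finrank ℝ E - 1)) :=
  calc
    ∫ x, f x ∂μ = ∫ x : ({(0)}ᶜ : Set E), f x.1 ∂(μ.comap (↑)) := by
      rw [integral_subtype_comap (measurableSet_singleton _).compl f, restrict_compl_singleton]
    _ = ∫ x, f (x.2.1 • x.1.1)
          ∂μ.toSphere.prod (.volumeIoiPow (Module.finrank ℝ E - 1)) := by
      rw [← μ.measurePreserving_homeomorphUnitSphereProd.integral_comp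
        (Homeomorph.measurableEmbedding _) fun x => f (x.2.1 • x.1.1)]
      refine integral_congr_ae (Filter.Eventually.of_forall fun x => ?_)
      have hx : ‖x.1‖ ≠ 0 := norm_ne_zero_iff.mpr x.2
      simp [smul_smul, hx]
    _ = ∫ x, g x.1 * h x.2.1 ∂μ.toSphere.prod (.volumeIoiPow (Module.finrank ℝ E - 1)) := by
      exact integral_congr_ae (Filter.Eventually.of_forall fun x => hf x.1 x.2.1 x.2.2)
    _ = _ := integral_prod_mul g fun r : Set.Ioi (0 : ℝ) => h r

theorem sum_norm_sq_unitVector {ι : Type*} [Fintype ι] (ψ : UnitVector ι) :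
    ∑ j, ‖ψ.1 j‖ ^ 2 = 1 := by
  rw [← EuclideanSpace.norm_sq_eq, norm_eq_of_mem_sphere, one_pow]

/-- The moments of a Haar random state: the average of `|ψ⟩⟨ψ|^{⊗k}` is a multiple of the sum of all
permutation operators. A word moment times a Gaussian is separable in polar coordinates with a radial
part that depends only on `k`, so the sphere inherits Wick's formula. -/
theorem exists_integral_haarState_word {ι : Type*} [Fintype ι] [DecidableEq ι] [Nonempty ι]
    (k : ℕ) : ∃ S : ℝ, ∀ a b : Fin k → ι,
      ∫ ψ : UnitVector ι, (∏ i, ψ.1 (a i)) * star (∏ i, ψ.1 (b i)) ∂(haarState ι) =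
        S * ((Finset.univ.filter fun σ : Equiv.Perm (Fin k) => b ∘ σ = a).card : ℂ) := by
  obtain ⟨c, hc, hcI⟩ := integral_eq_smul_integral_pi (ι := ι)
  set R : ℝ := ∫ r : Set.Ioi (0 : ℝ), (r.1 ^ (2 * k) * Real.exp (-r.1 ^ 2))
    ∂(.volumeIoiPow (Module.finrank ℝ (EuclideanSpace ℂ ι) - 1)) with hR
  have key : ∀ a b : Fin k → ι,
      (∫ ψ : UnitVector ι, (∏ i, ψ.1 (a i)) * star (∏ i, ψ.1 (b i))
        ∂(volume : Measure (EuclideanSpace ℂ ι)).toSphere) * R =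
      c * (Real.pi ^ Fintype.card ι *
        (Finset.univ.filter fun σ : Equiv.Perm (Fin k) => b ∘ σ = a).card) := fun a b => by
    rw [← integral_pi_gaussian_word, ← hcI, hR, ← integral_complex_ofReal]
    refine (integral_eq_integral_sphere_mul (volume : Measure (EuclideanSpace ℂ ι)) _
      (fun ψ => (∏ i, ψ.1 (a i)) * star (∏ i, ψ.1 (b i)))
      (fun r => ((r ^ (2 * k) * Real.exp (-r ^ 2) : ℝ) : ℂ)) fun u r hr => ?_).symm
    have hn : ∑ j, ‖(r • u.1) j‖ ^ 2 = r ^ 2 := by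
      simp [mul_pow, ← Finset.mul_sum, sum_norm_sq_unitVector u]
    rw [hn]
    simp only [PiLp.smul_apply, Complex.real_smul, Finset.prod_mul_distrib, Finset.prod_const,
      Finset.card_univ, Fintype.card_fin, star_mul', star_pow, Complex.star_def,
      Complex.conj_ofReal]
    push_cast
    ring
  -- a constant word has a positive Gaussian moment, so the radial integral does not vanish
  have hR0 : (R : ℂ) ≠ 0 := fun h0 => by
    obtain ⟨j⟩ := ‹Nonempty ι›
    have h1 := key (fun _ => j) (fun _ => j)
    have h2 : (Finset.univ.filter fun σ : Equiv.Perm (Fin k) =>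
        (fun _ : Fin k => j) ∘ σ = fun _ => j) = Finset.univ :=
      Finset.filter_true_of_mem fun _ _ => rfl
    rw [h0, mul_zero, eq_comm, h2] at h1
    simp [hc.ne', Real.pi_ne_zero, Finset.card_univ, Fintype.card_perm,
      Nat.factorial_ne_zero] at h1
  refine ⟨((volume : Measure (EuclideanSpace ℂ ι)).toSphere Set.univ)⁻¹.toReal *
    (c * Real.pi ^ Fintype.card ι / R), fun a b => ?_⟩
  rw [haarState, integral_smul_measure, Complex.real_smul, eq_div_of_mul_eq hR0 (key a b)]
  push_cast
  ring

instance haarState_isProbabilityMeasure {ι : Type*} [Fintype ι] [Nonempty ι] :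
    IsProbabilityMeasure (haarState ι) := by
  refine ⟨?_⟩
  rw [haarState, Measure.smul_apply, smul_eq_mul]
  refine ENNReal.inv_mul_cancel ?_ (measure_ne_top _ _)
  rw [Measure.measure_univ_ne_zero]
  exact Measure.toSphere_ne_zero _

theorem integrable_haarState {ι F : Type*} [Fintype ι] [Nonempty ι] [NormedAddCommGroup F]
    {f : UnitVector ι → F} (hf : Continuous f) : Integrable f (haarState ι) :=
  hf.integrable_of_hasCompactSupport (HasCompactSupport.of_compactSpace f)

theorem continuous_word {ι : Type*} [Fintype ι] {k : ℕ} (a : Fin k → ι) :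
    Continuous fun ψ : UnitVector ι => ∏ i, ψ.1 (a i) := by
  fun_prop

/-! ### Comparison of symmetrizations -/

/-- The squared norm of the unnormalized symmetrization `b ↦ ∑ σ, w (b ∘ σ)` of a tensor `w`. -/
noncomputable def symNormSq {ι : Type*} [Fintype ι] {k : ℕ} (w : (Fin k → ι) → ℂ) : ℝ :=
  ∑ b : Fin k → ι, ‖∑ σ : Equiv.Perm (Fin k), w (b ∘ σ)‖ ^ 2

theorem sum_word_comp_perm {ι M : Type*} [Fintype ι] [AddCommMonoid M] {k : ℕ}
    (σ : Equiv.Perm (Fin k)) (f : (Fin k → ι) → M) : ∑ b, f (b ∘ σ) = ∑ b, f b :=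
  Equiv.sum_comp (σ.symm.arrowCongr (Equiv.refl ι)) f

theorem sum_word_cons {ι M : Type*} [Fintype ι] [AddCommMonoid M] {k : ℕ}
    (f : (Fin (k + 1) → ι) → M) : ∑ b, f b = ∑ j : ι, ∑ a : Fin k → ι, f (Fin.cons j a) := by
  rw [← Fintype.sum_prod_type']
  exact (Equiv.sum_comp (Fin.consEquiv fun _ : Fin (k + 1) => ι) f).symm

/-- The sum of all permutation operators is `k!` times an orthogonal projection. -/
theorem factorial_mul_sum_perm_eq_symNormSq {ι : Type*} [Fintype ι] {k : ℕ}
    (w : (Fin k → ι) → ℂ) :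
    (k.factorial : ℂ) * ∑ σ : Equiv.Perm (Fin k), ∑ b : Fin k → ι, w (b ∘ σ) * star (w b) =
      symNormSq w := by
  have h1 : ∀ b : Fin k → ι, ((‖∑ σ : Equiv.Perm (Fin k), w (b ∘ σ)‖ ^ 2 : ℝ) : ℂ) =
      ∑ τ : Equiv.Perm (Fin k), ∑ σ : Equiv.Perm (Fin k), w (b ∘ σ) * star (w (b ∘ τ)) :=
    fun b => by
      rw [Complex.ofReal_pow, ← Complex.mul_conj', ← Complex.star_def, star_sum,
        Finset.sum_mul_sum, Finset.sum_comm]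
  rw [symNormSq, Complex.ofReal_sum]
  simp_rw [h1]
  have h2 : ∀ τ : Equiv.Perm (Fin k), ∑ b : Fin k → ι, ∑ σ : Equiv.Perm (Fin k),
      w (b ∘ σ) * star (w (b ∘ τ)) =
      ∑ σ : Equiv.Perm (Fin k), ∑ b : Fin k → ι, w (b ∘ σ) * star (w b) := fun τ => by
    rw [Finset.sum_comm, ← Equiv.sum_comp (Equiv.mulLeft τ)]
    refine Finset.sum_congr rfl fun σ _ => ?_
    exact sum_word_comp_perm τ fun b => w (b ∘ σ) * star (w b)
  refine Eq.symm (Finset.sum_comm.trans ?_)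
  rw [Finset.sum_congr rfl fun τ _ => h2 τ]
  simp [Fintype.card_perm]

/-- Symmetrizing in all `m + 1` slots costs at most a factor `(m + 1)²` over symmetrizing in the last
`m` slots: the full symmetrization is a sum of `m + 1` permuted copies of the partial one. -/
theorem symNormSq_le_sum_cons {ι : Type*} [Fintype ι] {m : ℕ} (w : (Fin (m + 1) → ι) → ℂ) :
    symNormSq w ≤ (m + 1) ^ 2 * ∑ j : ι, symNormSq fun a : Fin m → ι => w (Fin.cons j a) := by
  set g : (Fin (m + 1) → ι) → ℂ := fun b =>
    ∑ τ : Equiv.Perm (Fin m), w (b ∘ Equiv.Perm.decomposeFin.symm (0, τ)) with hg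
  have h1 : ∀ b, ∑ σ : Equiv.Perm (Fin (m + 1)), w (b ∘ σ) =
      ∑ p : Fin (m + 1), g (b ∘ Equiv.swap 0 p) := fun b => by
    rw [← Equiv.sum_comp Equiv.Perm.decomposeFin.symm, Fintype.sum_prod_type]
    refine Finset.sum_congr rfl fun p _ => Finset.sum_congr rfl fun τ _ => congrArg w ?_
    funext i
    refine Fin.cases ?_ (fun i => ?_) i <;> simp
  have h2 : ∀ b, ‖∑ σ : Equiv.Perm (Fin (m + 1)), w (b ∘ σ)‖ ^ 2 ≤
      (m + 1) * ∑ p : Fin (m + 1), ‖g (b ∘ Equiv.swap 0 p)‖ ^ 2 := fun b => by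
    rw [h1]
    refine (pow_le_pow_left₀ (norm_nonneg _) (norm_sum_le _ _) 2).trans ?_
    refine (sq_sum_le_card_mul_sum_sq (s := Finset.univ)).trans_eq ?_
    simp
  refine (Finset.sum_le_sum fun b _ => h2 b).trans_eq ?_
  rw [← Finset.mul_sum, Finset.sum_comm]
  have h3 : ∀ p : Fin (m + 1), ∑ b : Fin (m + 1) → ι, ‖g (b ∘ Equiv.swap 0 p)‖ ^ 2 =
      ∑ b, ‖g b‖ ^ 2 := fun p => sum_word_comp_perm (Equiv.swap 0 p) fun b => ‖g b‖ ^ 2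
  have h4 : ∑ b, ‖g b‖ ^ 2 = ∑ j : ι, symNormSq fun a : Fin m → ι => w (Fin.cons j a) := by
    rw [sum_word_cons]
    refine Finset.sum_congr rfl fun j _ => Finset.sum_congr rfl fun a _ => ?_
    refine congrArg (fun z : ℂ => ‖z‖ ^ 2) (Finset.sum_congr rfl fun τ _ => congrArg w ?_)
    funext i
    refine Fin.cases ?_ (fun i => ?_) i <;> simp
  simp_rw [h3]
  rw [h4]
  simp only [Finset.sum_const, Finset.card_univ, Fintype.card_fin, nsmul_eq_mul]
  push_cast
  ring

/-! ### Haar averages of quadratic forms -/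

/-- The mean square of the form `∑ a, w a ψ^a` on Haar random states is a multiple of the squared norm
of the symmetrization of `w`; `S` is the constant of `exists_integral_haarState_word`. -/
theorem integral_norm_sq_eq_symNormSq {ι : Type*} [Fintype ι] [DecidableEq ι] [Nonempty ι]
    {k : ℕ} {S : ℝ} (hS : ∀ a b : Fin k → ι,
      ∫ ψ : UnitVector ι, (∏ i, ψ.1 (a i)) * star (∏ i, ψ.1 (b i)) ∂(haarState ι) =
        S * ((Finset.univ.filter fun σ : Equiv.Perm (Fin k) => b ∘ σ = a).card : ℂ))
    (w : (Fin k → ι) → ℂ) :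
    k.factorial * ∫ ψ : UnitVector ι, ‖∑ a, w a * ∏ i, ψ.1 (a i)‖ ^ 2 ∂(haarState ι) =
      S * symNormSq w := by
  have h1 : ((∫ ψ : UnitVector ι, ‖∑ a, w a * ∏ i, ψ.1 (a i)‖ ^ 2 ∂(haarState ι) : ℝ) : ℂ) =
      S * ∑ σ : Equiv.Perm (Fin k), ∑ b : Fin k → ι, w (b ∘ σ) * star (w b) := by
    have h2 : ∀ ψ : UnitVector ι, ((‖∑ a, w a * ∏ i, ψ.1 (a i)‖ ^ 2 : ℝ) : ℂ) =
        ∑ b, ∑ a, (w a * star (w b)) * ((∏ i, ψ.1 (a i)) * star (∏ i, ψ.1 (b i))) :=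
      fun ψ => by
        rw [Complex.ofReal_pow, ← Complex.mul_conj', ← Complex.star_def, star_sum,
          Finset.sum_mul_sum, Finset.sum_comm]
        refine Finset.sum_congr rfl fun b _ => Finset.sum_congr rfl fun a _ => ?_
        rw [star_mul']
        ring
    have hint : ∀ a b : Fin k → ι, Integrable (fun ψ : UnitVector ι =>
        (w a * star (w b)) * ((∏ i, ψ.1 (a i)) * star (∏ i, ψ.1 (b i)))) (haarState ι) :=
      fun a b => integrable_haarState
        (continuous_const.mul ((continuous_word a).mul (continuous_word b).star))
    rw [← integral_complex_ofReal]
    simp_rw [h2]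
    rw [integral_finsetSum _ fun b _ => integrable_finsetSum _ fun a _ => hint a b,
      Finset.sum_comm, Finset.mul_sum]
    refine Finset.sum_congr rfl fun b _ => ?_
    rw [integral_finsetSum _ fun a _ => hint a b]
    simp_rw [integral_const_mul, hS, Finset.card_filter, Nat.cast_sum, Finset.mul_sum]
    rw [Finset.sum_comm]
    refine Finset.sum_congr rfl fun σ _ => ?_
    rw [Finset.sum_eq_single (b ∘ σ) (fun a _ ha => by rw [if_neg (Ne.symm ha)]; simp)
      (by simp)]
    simp
    ring
  have h3 := factorial_mul_sum_perm_eq_symNormSq w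
  have h4 : ((k.factorial * ∫ ψ : UnitVector ι, ‖∑ a, w a * ∏ i, ψ.1 (a i)‖ ^ 2
      ∂(haarState ι) : ℝ) : ℂ) = ((S * symNormSq w : ℝ) : ℂ) := by
    push_cast at h1 ⊢
    rw [h1, ← h3]
    ring
  exact_mod_cast h4

/-- The normalizing constants of consecutive Haar moments, compared by inserting
`∑ j, |ψ j|² = 1` into the moment of a constant word. -/
theorem haar_moment_recurrence {ι : Type*} [Fintype ι] [DecidableEq ι] [Nonempty ι] {m : ℕ}
    {S S' : ℝ} (hS : ∀ a b : Fin m → ι,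
      ∫ ψ : UnitVector ι, (∏ i, ψ.1 (a i)) * star (∏ i, ψ.1 (b i)) ∂(haarState ι) =
        S * ((Finset.univ.filter fun σ : Equiv.Perm (Fin m) => b ∘ σ = a).card : ℂ))
    (hS' : ∀ a b : Fin (m + 1) → ι,
      ∫ ψ : UnitVector ι, (∏ i, ψ.1 (a i)) * star (∏ i, ψ.1 (b i)) ∂(haarState ι) =
        S' * ((Finset.univ.filter fun σ : Equiv.Perm (Fin (m + 1)) => b ∘ σ = a).card : ℂ)) :
    S = (m + Fintype.card ι) * S' := by
  obtain ⟨i₀⟩ := ‹Nonempty ι›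
  have hcount : ∀ j l : ι, letterCount (Fin.cons j (fun _ => i₀) : Fin (m + 1) → ι) l =
      (if j = l then 1 else 0) + if i₀ = l then m else 0 := fun j l => by
    rw [letterCount, Finset.card_filter, Fin.sum_univ_succ]
    simp [Finset.sum_ite_irrel]
  have hcons : ∀ j : ι,
      ((Finset.univ.filter fun σ : Equiv.Perm (Fin (m + 1)) =>
        (Fin.cons j (fun _ => i₀) : Fin (m + 1) → ι) ∘ σ = Fin.cons j fun _ => i₀).card) =
      (if j = i₀ then m else 0) * m.factorial + m.factorial := fun j => by
    rw [card_perm_comp_eq, if_pos rfl, Finset.prod_eq_single i₀ _ (by simp)]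
    · rw [hcount, if_pos rfl]
      split_ifs
      · rw [add_comm, Nat.factorial_succ]
        ring
      · simp
    · intro l _ hl
      rw [hcount, if_neg (Ne.symm hl)]
      split_ifs <;> rfl
  have hconst : ((Finset.univ.filter fun σ : Equiv.Perm (Fin m) =>
      (fun _ : Fin m => i₀) ∘ σ = fun _ => i₀).card) = m.factorial := by
    refine (congrArg Finset.card (Finset.filter_true_of_mem fun _ _ => rfl)).trans ?_
    rw [Finset.card_univ, Fintype.card_perm, Fintype.card_fin]
  have hsplit : ∀ ψ : UnitVector ι,
      (∏ _i : Fin m, ψ.1 i₀) * star (∏ _i : Fin m, ψ.1 i₀) =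
      ∑ j, (∏ i, ψ.1 ((Fin.cons j fun _ => i₀ : Fin (m + 1) → ι) i)) *
        star (∏ i, ψ.1 ((Fin.cons j fun _ => i₀ : Fin (m + 1) → ι) i)) := fun ψ => by
    have h1 : ∑ j, ψ.1 j * star (ψ.1 j) = 1 := by
      simp_rw [Complex.star_def, Complex.mul_conj']
      exact_mod_cast sum_norm_sq_unitVector ψ
    simp_rw [Fin.prod_univ_succ, Fin.cons_zero, Fin.cons_succ, star_mul']
    rw [← one_mul (_ * star _), ← h1, Finset.sum_mul]
    exact Finset.sum_congr rfl fun j _ => by ring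
  have hfac : (m.factorial : ℂ) ≠ 0 := by exact_mod_cast m.factorial_ne_zero
  have h1 := hS (fun _ => i₀) fun _ => i₀
  have hint : ∀ j, Integrable (fun ψ : UnitVector ι =>
      (∏ i, ψ.1 ((Fin.cons j fun _ => i₀ : Fin (m + 1) → ι) i)) *
        star (∏ i, ψ.1 ((Fin.cons j fun _ => i₀ : Fin (m + 1) → ι) i))) (haarState ι) :=
    fun j => integrable_haarState ((continuous_word _).mul (continuous_word _).star)
  rw [integral_congr_ae (Filter.Eventually.of_forall hsplit),
    integral_finsetSum _ fun j _ => hint j, hconst] at h1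
  simp_rw [hS', hcons] at h1
  rw [← Finset.mul_sum, ← Nat.cast_sum, Finset.sum_add_distrib, ← Finset.sum_mul] at h1
  simp only [Finset.sum_ite_eq', Finset.mem_univ, if_true, Finset.sum_const, Finset.card_univ,
    smul_eq_mul] at h1
  push_cast at h1
  have h2 : (S : ℂ) = (m + Fintype.card ι) * S' :=
    mul_right_cancel₀ hfac (by rw [← h1]; ring)
  exact_mod_cast h2

theorem haar_moment_nonneg {ι : Type*} [Fintype ι] [DecidableEq ι] [Nonempty ι] {k : ℕ}
    {S : ℝ} (hS : ∀ a b : Fin k → ι,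
      ∫ ψ : UnitVector ι, (∏ i, ψ.1 (a i)) * star (∏ i, ψ.1 (b i)) ∂(haarState ι) =
        S * ((Finset.univ.filter fun σ : Equiv.Perm (Fin k) => b ∘ σ = a).card : ℂ)) :
    0 ≤ S := by
  obtain ⟨i₀⟩ := ‹Nonempty ι›
  have h1 := hS (fun _ => i₀) fun _ => i₀
  simp_rw [Complex.star_def, Complex.mul_conj', ← Complex.ofReal_pow] at h1
  rw [integral_complex_ofReal] at h1
  have h2 : ∫ ψ : UnitVector ι, ‖∏ _i : Fin k, ψ.1 i₀‖ ^ 2 ∂(haarState ι) =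
      S * (Finset.univ.filter fun σ : Equiv.Perm (Fin k) =>
        (fun _ : Fin k => i₀) ∘ σ = fun _ => i₀).card := by exact_mod_cast h1
  have h3 : 0 ≤ ∫ ψ : UnitVector ι, ‖∏ _i : Fin k, ψ.1 i₀‖ ^ 2 ∂(haarState ι) :=
    integral_nonneg fun _ => sq_nonneg _
  rw [h2] at h3
  refine nonneg_of_mul_nonneg_left h3 (Nat.cast_pos.mpr (Finset.card_pos.mpr ⟨1, ?_⟩))
  simp

/-- The operator inequality
`E[|ψ⟩⟨ψ|^{⊗(m+1)}] ≤ (m + 1) / (m + d) • (I ⊗ E[|ψ⟩⟨ψ|^{⊗m}])` in dimension `d`, tested on a vector `w`. -/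
theorem integral_norm_sq_le_sum_cons {ι : Type*} [Fintype ι] [DecidableEq ι] [Nonempty ι]
    {m : ℕ} (w : (Fin (m + 1) → ι) → ℂ) :
    (m + Fintype.card ι) *
        ∫ ψ : UnitVector ι, ‖∑ a, w a * ∏ i, ψ.1 (a i)‖ ^ 2 ∂(haarState ι) ≤
      (m + 1) * ∑ j : ι, ∫ ψ : UnitVector ι,
        ‖∑ a : Fin m → ι, w (Fin.cons j a) * ∏ i, ψ.1 (a i)‖ ^ 2 ∂(haarState ι) := by
  obtain ⟨S, hS⟩ := exists_integral_haarState_word (ι := ι) m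
  obtain ⟨S', hS'⟩ := exists_integral_haarState_word (ι := ι) (m + 1)
  have hrec := haar_moment_recurrence hS hS'
  have hS'0 := haar_moment_nonneg hS'
  have hfac : (0 : ℝ) < (m + 1).factorial := by exact_mod_cast (m + 1).factorial_pos
  refine le_of_mul_le_mul_left ?_ hfac
  have h1 := integral_norm_sq_eq_symNormSq hS' w
  have h2 : m.factorial * ∑ j : ι, ∫ ψ : UnitVector ι,
      ‖∑ a : Fin m → ι, w (Fin.cons j a) * ∏ i, ψ.1 (a i)‖ ^ 2 ∂(haarState ι) =
      S * ∑ j : ι, symNormSq fun a : Fin m → ι => w (Fin.cons j a) := by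
    rw [Finset.mul_sum, Finset.mul_sum]
    exact Finset.sum_congr rfl fun j _ =>
      integral_norm_sq_eq_symNormSq hS fun a : Fin m → ι => w (Fin.cons j a)
  have hcard : (0 : ℝ) ≤ m + Fintype.card ι := by positivity
  calc ((m + 1).factorial : ℝ) * ((m + Fintype.card ι) *
        ∫ ψ : UnitVector ι, ‖∑ a, w a * ∏ i, ψ.1 (a i)‖ ^ 2 ∂(haarState ι))
      = (m + Fintype.card ι) * S' * symNormSq w := by rw [mul_left_comm, h1, mul_assoc]
    _ ≤ (m + Fintype.card ι) * S' * ((m + 1) ^ 2 *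
        ∑ j : ι, symNormSq fun a : Fin m → ι => w (Fin.cons j a)) :=
      mul_le_mul_of_nonneg_left (symNormSq_le_sum_cons w) (mul_nonneg hcard hS'0)
    _ = (m + 1) ^ 2 * (S * ∑ j : ι, symNormSq fun a : Fin m → ι => w (Fin.cons j a)) := by
      rw [hrec]
      ring
    _ = _ := by
      rw [← h2, Nat.factorial_succ]
      push_cast
      ring

/-! ### Measurements on Haar random states -/

/-- The outcome probabilities of a measurement with Kraus operators `B x` sum to the squared norm of
the measured vector. -/
theorem sum_norm_sq_mulVec_of_sum_eq_one {X κ : Type*} [Fintype X] [Fintype κ]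
    [DecidableEq κ] {B : X → Matrix κ κ ℂ} (hB : ∑ x, (B x).conjTranspose * B x = 1)
    (v : κ → ℂ) : ∑ x, ∑ r, ‖∑ a, B x r a * v a‖ ^ 2 = ∑ a, ‖v a‖ ^ 2 := by
  have h1 : ∀ u : κ → ℂ, ((∑ a, ‖u a‖ ^ 2 : ℝ) : ℂ) = dotProduct (star u) u := fun u => by
    simp [dotProduct, Complex.conj_mul']
  have h2 : ∀ x, ((∑ r, ‖∑ a, B x r a * v a‖ ^ 2 : ℝ) : ℂ) =
      dotProduct (star v) (((B x).conjTranspose * B x).mulVec v) := fun x => by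
    rw [← Matrix.mulVec_mulVec, Matrix.dotProduct_mulVec, ← Matrix.star_mulVec, ← h1]
    rfl
  have h3 : ((∑ x, ∑ r, ‖∑ a, B x r a * v a‖ ^ 2 : ℝ) : ℂ) = ((∑ a, ‖v a‖ ^ 2 : ℝ) : ℂ) := by
    rw [Complex.ofReal_sum, Finset.sum_congr rfl fun x _ => h2 x, ← dotProduct_sum,
      ← Matrix.sum_mulVec, hB, Matrix.one_mulVec, h1]
  exact_mod_cast h3

theorem sum_norm_sq_word {ι : Type*} [Fintype ι] [DecidableEq ι] (ψ : UnitVector ι) (k : ℕ) :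
    ∑ a : Fin k → ι, ‖∏ i, ψ.1 (a i)‖ ^ 2 = 1 := by
  simp_rw [norm_prod, ← Finset.prod_pow]
  rw [← Fintype.piFinset_univ, Finset.sum_prod_piFinset Finset.univ fun _ j => ‖ψ.1 j‖ ^ 2]
  simp [sum_norm_sq_unitVector]

/-- The total success weight of a measurement with Kraus operators `B x` on the states obtained from
`E[|ψ⟩⟨ψ|^{⊗(m+1)}]` by applying the diagonal unitaries `s x` to the first register. After the first
register is replaced by the maximally mixed state, `s x` no longer matters and the weights sum to the
dimension. -/
theorem sum_integral_povm_le {X ι : Type*} [Fintype X] [Fintype ι] [DecidableEq ι] [Nonempty ι]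
    {m : ℕ} {B : X → Matrix (Fin (m + 1) → ι) (Fin (m + 1) → ι) ℂ}
    (hB : ∑ x, (B x).conjTranspose * B x = 1) {s : X → ι → ℂ} (hs : ∀ x j, ‖s x j‖ = 1) :
    (m + Fintype.card ι) * ∑ x, ∑ r, ∫ ψ : UnitVector ι,
        ‖∑ a, B x r a * s x (a 0) * ∏ i, ψ.1 (a i)‖ ^ 2 ∂(haarState ι) ≤
      (m + 1) * Fintype.card ι := by
  have h1 : ∀ x r, (m + Fintype.card ι) * ∫ ψ : UnitVector ι,
        ‖∑ a, B x r a * s x (a 0) * ∏ i, ψ.1 (a i)‖ ^ 2 ∂(haarState ι) ≤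
      (m + 1) * ∑ j : ι, ∫ ψ : UnitVector ι,
        ‖∑ a : Fin m → ι, B x r (Fin.cons j a) * ∏ i, ψ.1 (a i)‖ ^ 2 ∂(haarState ι) :=
    fun x r => by
      refine (integral_norm_sq_le_sum_cons fun a => B x r a * s x (a 0)).trans_eq ?_
      congr 2
      funext j
      congr 1
      funext ψ
      simp_rw [Fin.cons_zero, mul_right_comm _ (s x j), ← Finset.sum_mul]
      rw [norm_mul, hs, mul_one]
  have hint : ∀ x r (j : ι), Integrable (fun ψ : UnitVector ι =>
      ‖∑ a : Fin m → ι, B x r (Fin.cons j a) * ∏ i, ψ.1 (a i)‖ ^ 2) (haarState ι) :=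
    fun x r j => integrable_haarState ((continuous_finsetSum _ fun a _ =>
      continuous_const.mul (continuous_word a)).norm.pow 2)
  have h2 : ∀ (j : ι) (ψ : UnitVector ι),
      ∑ x, ∑ r, ‖∑ a : Fin m → ι, B x r (Fin.cons j a) * ∏ i, ψ.1 (a i)‖ ^ 2 = 1 :=
    fun j ψ => by
      -- the vector `e_j ⊗ ψ^{⊗m}`
      set v : (Fin (m + 1) → ι) → ℂ :=
        fun a => if a 0 = j then ∏ i : Fin m, ψ.1 (a i.succ) else 0 with hv
      have hrow : ∀ c : (Fin (m + 1) → ι) → ℂ,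
          ∑ a, c a * v a = ∑ a : Fin m → ι, c (Fin.cons j a) * ∏ i, ψ.1 (a i) := fun c => by
        rw [sum_word_cons, Finset.sum_eq_single j (fun l _ hl => by simp [hv, hl]) (by simp)]
        simp [hv]
      have hnorm : ∑ a, ‖v a‖ ^ 2 = 1 := by
        rw [sum_word_cons, Finset.sum_eq_single j (fun l _ hl => by simp [hv, hl]) (by simp)]
        simpa only [hv, Fin.cons_zero, Fin.cons_succ, if_true] using sum_norm_sq_word ψ m
      refine Eq.trans ?_ ((sum_norm_sq_mulVec_of_sum_eq_one hB v).trans hnorm)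
      simp_rw [hrow]
  have h4 : ∑ x, ∑ r, ∑ j : ι, ∫ ψ : UnitVector ι,
      ‖∑ a : Fin m → ι, B x r (Fin.cons j a) * ∏ i, ψ.1 (a i)‖ ^ 2 ∂(haarState ι) =
      Fintype.card ι := by
    have h5 : ∀ j : ι, ∑ x, ∑ r, ∫ ψ : UnitVector ι,
        ‖∑ a : Fin m → ι, B x r (Fin.cons j a) * ∏ i, ψ.1 (a i)‖ ^ 2 ∂(haarState ι) = 1 :=
      fun j => by
        simp_rw [← integral_finsetSum _ fun r _ => hint _ r j]
        rw [← integral_finsetSum _ fun x _ => integrable_finsetSum _ fun r _ => hint x r j]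
        simp_rw [h2]
        simp
    rw [Finset.sum_congr rfl fun x _ => Finset.sum_comm, Finset.sum_comm,
      Finset.sum_congr rfl fun j _ => h5 j]
    simp
  refine le_of_le_of_eq ?_ (congrArg (fun t : ℝ => (m + 1) * t) h4)
  simp_rw [Finset.mul_sum (Finset.univ : Finset X),
    Finset.mul_sum (Finset.univ : Finset (Fin (m + 1) → ι))]
  exact Finset.sum_le_sum fun x _ => Finset.sum_le_sum fun r _ => h1 x r

/-! ### Pauli strings and the guessing probability -/

theorem tensorProd_diagonal {ι : Type*} [DecidableEq ι] {k : ℕ} (f : Fin k → ι → ℂ) :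
    tensorProd (fun i => Matrix.diagonal (f i)) = Matrix.diagonal fun a => ∏ i, f i (a i) := by
  ext a b
  rw [tensorProd, Matrix.of_apply, Matrix.diagonal_apply]
  split_ifs with h
  · simp [h]
  · obtain ⟨i, hi⟩ := Function.ne_iff.mp h
    exact Finset.prod_eq_zero (Finset.mem_univ i) (Matrix.diagonal_apply_ne _ hi)

/-- The character `j ↦ (-1)^(x · j)` of the group of bit strings: the diagonal of `Z^x`. -/
def zSign {n : ℕ} (x j : BitString n) : ℂ :=
  ∏ i, if x i then (if j i then -1 else 1) else 1

theorem norm_zSign {n : ℕ} (x j : BitString n) : ‖zSign x j‖ = 1 := by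
  rw [zSign, norm_prod]
  refine Finset.prod_eq_one fun i _ => ?_
  split_ifs <;> simp

theorem star_zSign {n : ℕ} (x j : BitString n) : star (zSign x j) = zSign x j := by
  rw [zSign, star_prod]
  refine Finset.prod_congr rfl fun i _ => ?_
  split_ifs <;> simp

theorem pauliZString_eq_diagonal {n : ℕ} (x : BitString n) :
    pauliZString x = Matrix.diagonal (zSign x) := by
  have h1 : (fun i => if x i then pauliZ else 1) = fun i =>
      Matrix.diagonal fun b : Bool => if x i then (if b then (-1 : ℂ) else 1) else 1 := by
    funext i
    split_ifs
    · rfl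
    · exact Matrix.diagonal_one.symm
  rw [pauliZString, h1, tensorProd_diagonal]
  rfl

theorem pauliZOnFirst_eq_diagonal {n : ℕ} (m : ℕ) (x : BitString n) :
    pauliZOnFirst m x = Matrix.diagonal fun a => zSign x (a 0) := by
  have h1 : (Fin.cons (pauliZString x) fun _ => 1 :
      Fin (m + 1) → Matrix (BitString n) (BitString n) ℂ) = fun i =>
      Matrix.diagonal ((Fin.cons (zSign x) fun _ _ => 1 : Fin (m + 1) → BitString n → ℂ) i) := by
    funext i
    refine Fin.cases ?_ (fun i => ?_) i
    · exact pauliZString_eq_diagonal x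
    · exact Matrix.diagonal_one.symm
  rw [pauliZOnFirst, h1, tensorProd_diagonal]
  simp [Fin.prod_univ_succ]

/-- The trace `Tr[BᴴB ρ_x]` as a Haar average of `‖B (Z^x ⊗ I) ψ^{⊗(m+1)}‖²`. -/
theorem trace_mul_rho {n m : ℕ} (x : BitString n)
    (B : Matrix (Fin (m + 1) → BitString n) (Fin (m + 1) → BitString n) ℂ) :
    (B.conjTranspose * B * rho m x).trace = ((∑ r, ∫ ψ : UnitVector (BitString n),
      ‖∑ a, B r a * zSign x (a 0) * ∏ i, ψ.1 (a i)‖ ^ 2 ∂(haarState (BitString n)) : ℝ) : ℂ) := by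
  have hrho : ∀ a b, rho m x a b = ∫ ψ : UnitVector (BitString n),
      (zSign x (a 0) * ∏ i, ψ.1 (a i)) * star (zSign x (b 0) * ∏ i, ψ.1 (b i))
        ∂(haarState (BitString n)) := fun a b => by
    rw [rho, Matrix.of_apply]
    congr 1
    funext ψ
    rw [pauliZOnFirst_eq_diagonal, Matrix.mul_diagonal, Matrix.diagonal_mul, tensorProd,
      Matrix.of_apply, star_mul', star_zSign, star_prod]
    simp only [ketBra, Matrix.of_apply, Finset.prod_mul_distrib]
    ring
  have hcont : ∀ a : Fin (m + 1) → BitString n, Continuous fun ψ : UnitVector (BitString n) =>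
      zSign x (a 0) * ∏ i, ψ.1 (a i) := fun a => continuous_const.mul (continuous_word a)
  have hint : ∀ r a b, Integrable (fun ψ : UnitVector (BitString n) =>
      (B r a * star (B r b)) * ((zSign x (a 0) * ∏ i, ψ.1 (a i)) *
        star (zSign x (b 0) * ∏ i, ψ.1 (b i)))) (haarState (BitString n)) := fun r a b =>
    integrable_haarState (continuous_const.mul ((hcont a).mul (hcont b).star))
  have hrow : ∀ r, ((∫ ψ : UnitVector (BitString n),
      ‖∑ a, B r a * zSign x (a 0) * ∏ i, ψ.1 (a i)‖ ^ 2 ∂(haarState (BitString n)) : ℝ) : ℂ) =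
      ∑ b, ∑ a, (B r a * star (B r b)) * rho m x a b := fun r => by
    rw [← integral_complex_ofReal]
    simp_rw [hrho, ← integral_const_mul]
    simp_rw [← integral_finsetSum _ fun a _ => hint r a _]
    rw [← integral_finsetSum _ fun b _ => integrable_finsetSum _ fun a _ => hint r a b]
    congr 1
    funext ψ
    rw [Complex.ofReal_pow, ← Complex.mul_conj', ← Complex.star_def, star_sum,
      Finset.sum_mul_sum, Finset.sum_comm]
    refine Finset.sum_congr rfl fun b _ => Finset.sum_congr rfl fun a _ => ?_
    simp only [star_mul']
    ring
  rw [Complex.ofReal_sum, Finset.sum_congr rfl fun r _ => hrow r, Matrix.trace, Finset.sum_comm]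
  refine Finset.sum_congr rfl fun b _ => ?_
  rw [Matrix.diag_apply, Matrix.mul_apply, Finset.sum_comm]
  refine Finset.sum_congr rfl fun a _ => ?_
  rw [Matrix.mul_apply, Finset.sum_mul]
  refine Finset.sum_congr rfl fun r _ => ?_
  rw [Matrix.conjTranspose_apply]
  ring

open scoped MatrixOrder Matrix.Norms.L2Operator in
theorem exists_eq_conjTranspose_mul_self {κ : Type*} [Fintype κ] [DecidableEq κ]
    {M : Matrix κ κ ℂ} (hM : M.PosSemidef) : ∃ B : Matrix κ κ ℂ, M = B.conjTranspose * B :=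
  CStarAlgebra.nonneg_iff_eq_star_mul_self.mp hM.nonneg

theorem guessingProb_rho_le {n m : ℕ}
    {M : BitString n → Matrix (Fin (m + 1) → BitString n) (Fin (m + 1) → BitString n) ℂ}
    (hM : IsPOVM M) :
    guessingProb M (fun x => rho m x) ≤ (m + 1) / (m + 2 ^ n) := by
  choose B hB using fun x => exists_eq_conjTranspose_mul_self (hM.posSemidef x)
  have hsum : ∑ x, (B x).conjTranspose * B x = 1 := by
    rw [← hM.sum_eq_one]
    exact Finset.sum_congr rfl fun x _ => (hB x).symm
  have h1 := sum_integral_povm_le hsum norm_zSign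
  have h2 : guessingProb M (fun x => rho m x) = (2 ^ n)⁻¹ * ∑ x, ∑ r,
      ∫ ψ : UnitVector (BitString n),
        ‖∑ a, B x r a * zSign x (a 0) * ∏ i, ψ.1 (a i)‖ ^ 2 ∂(haarState (BitString n)) := by
    rw [guessingProb]
    congr 1
    · simp
    · refine Finset.sum_congr rfl fun x _ => ?_
      rw [hB x, trace_mul_rho, Complex.ofReal_re]
  have hcard : (Fintype.card (BitString n) : ℝ) = 2 ^ n := by simp
  rw [hcard] at h1
  have hd : (0 : ℝ) < 2 ^ n := by positivity
  rw [h2, inv_mul_le_iff₀ hd, ← mul_div_assoc, le_div_iff₀ (by positivity)]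
  linarith

theorem mainTheorem3 :
    ∃ C : ℝ, 0 < C ∧
      ∀ n m : ℕ, 1 ≤ m → 2 * (m + 1) < 2 ^ n →
        ∀ M : BitString n →
            Matrix (Fin (m + 1) → BitString n) (Fin (m + 1) → BitString n) ℂ,
          IsPOVM M →
            guessingProb M (fun x => rho m x) <
              C * Real.sqrt ((m : ℝ) / 2 ^ n + (m : ℝ) ^ 7 / 2 ^ (3 * n)) := by
  -- the guessing probability is at most `2t` for `t = m / 2^n ≤ 1`, and then `t ≤ √t`; `3` in place
  -- of `2` makes the inequality strict
  refine ⟨3, by norm_num, fun n m hm hmn M hM => ?_⟩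
  have hd : (0 : ℝ) < 2 ^ n := by positivity
  have hm' : (1 : ℝ) ≤ m := by exact_mod_cast hm
  have hmn' : 2 * ((m : ℝ) + 1) < 2 ^ n := by exact_mod_cast hmn
  set t : ℝ := m / 2 ^ n with ht
  have ht0 : 0 < t := by positivity
  have ht1 : t ≤ 1 := by rw [ht, div_le_one hd]; linarith
  calc guessingProb M (fun x => rho m x) ≤ (m + 1) / (m + 2 ^ n) := guessingProb_rho_le hM
    _ ≤ (2 * m) / 2 ^ n := by gcongr <;> linarith
    _ = 2 * t := by rw [ht, mul_div_assoc]
    _ < 3 * t := by linarith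
    _ ≤ 3 * Real.sqrt t := by
      gcongr
      exact Real.le_sqrt_of_sq_le (by nlinarith)
    _ ≤ 3 * Real.sqrt (t + (m : ℝ) ^ 7 / 2 ^ (3 * n)) := by
      gcongr
      exact le_add_of_nonneg_right (by positivity)
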